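/- Let $R$ be an associative ring with $1$; modules are unital right $R$-modules. We use the following notions. For an infinite cardinal $\kappa$, a module is $<\kappa$-generated if it has a generating set of cardinality $<\kappa$, and $<\kappa$-presented if it is isomorphic to $F/K$ with $F$ free of rank $<\kappa$ and $K$ a $<\kappa$-generated submodule of $F$. A filtration of a module $M$ is an increasing chain $(M_\alpha\mid\alpha\le\lambda)$ of submodules, indexed by ordinals, with $M_0=0$, $M_\lambda=M$ and $M_\alpha=\bigcup_{\beta<\alpha}M_\beta$ for every limit ordinal $\alpha\le\lambda$. A module $M$ is a transfinite extension of modules in a class $\mathcal C$ if it has a filtration $(M_\alpha\mid\alpha\le\lambda)$ such that for every $\alpha<\lambda$ the module $M_{\alpha+1}/M_\alpha$ is isomorphic to a module in $\mathcal C$. A class $\mathcal A$ is closed under transfinite extensions if it contains every transfinite extension of modules in $\mathcal A$. A class $\mathcal A$ is deconstructible if there is an infinite cardinal $\kappa$ such that every module in $\mathcal A$ is a transfinite extension of $<\kappa$-presented modules belonging to $\mathcal A$. An $\aleph_1$-dense system in a module $M$ is an upward directed family $\mathcal S$ of submodules of $M$ that is closed under unions of nonempty countable well-ordered ascending chains and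 such that every countable subset of $M$ is contained in a member of $\mathcal S$. **Theorem.** Let $\mathcal A'\subseteq\mathcal A$ be classes of $R$-modules closed under isomorphisms. Assume that $\mathcal A'$ is closed under countable direct sums, and that $\mathcal A$ is deconstructible, closed under transfinite extensions and closed under direct summands. Assume moreover that $\mathcal A$ contains every module $M$ that has an $\aleph_1$-dense system all of whose members are in $\mathcal A'$. Then $\mathcal A$ contains every countable direct limit of modules in $\mathcal A'$: if $N$ is the direct limit of a direct system of modules from $\mathcal A'$ indexed by a nonempty countable directed set, then $N\in\mathcal A$. -/

import Mathlib

open CategoryTheory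
open scoped Cardinal DirectSum

universe u w

namespace ModuleClass

section Modules

variable {S : Type u} [Ring S]

/-- A module is `< κ`-generated: it has a generating set of cardinality `< κ`. -/
def IsLTGenerated (S : Type u) [Ring S] (κ : Cardinal.{u}) (M : Type u) [AddCommGroup M]
    [Module S M] : Prop :=
  ∃ X : Set M, #X < κ ∧ Submodule.span S X = ⊤

/-- A module is `< κ`-presented: it is an epimorphic image of a free module on fewer than `κ`
generators, with a `< κ`-generated kernel. -/
def IsLTPresented (S : Type u) [Ring S] (κ : Cardinal.{u}) (M : Type u) [AddCommGroup M]
    [Module S M] : Prop :=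
  ∃ (B : Type u) (p : (B →₀ S) →ₗ[S] M),
    #B < κ ∧ Function.Surjective p ∧ IsLTGenerated S κ (LinearMap.ker p)

/-- `(F α ∣ α ≤ l)` is a filtration of `M`: an increasing continuous chain of submodules from `0`
to `M`. (The values `F α` for `α > l` are irrelevant. The union of a nonempty chain of submodules
is its supremum.) -/
structure IsFiltration {M : Type u} [AddCommGroup M] [Module S M] (l : Ordinal.{u})
    (F : Ordinal.{u} → Submodule S M) : Prop where
  zero : F 0 = ⊥
  mono : ∀ α β : Ordinal.{u}, α ≤ β → β ≤ l → F α ≤ F β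
  top : F l = ⊤
  limit : ∀ α : Ordinal.{u}, α ≤ l → Order.IsSuccLimit α → F α = ⨆ β : Set.Iio α, F β

/-- `M` is a transfinite extension of modules in `C`: it has a filtration all of whose consecutive
factors `F (α + 1) / F α`, `α < l`, are isomorphic to modules in `C`. -/
def IsTransfiniteExtension (C : ObjectProperty (ModuleCat.{u} S)) (M : ModuleCat.{u} S) : Prop :=
  ∃ (l : Ordinal.{u}) (F : Ordinal.{u} → Submodule S M), IsFiltration l F ∧
    ∀ α < l, ∃ X : ModuleCat.{u} S, C X ∧
      Nonempty ((↥(F (Order.succ α)) ⧸ (F α).submoduleOf (F (Order.succ α))) ≃ₗ[S] X)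

/-- `A` contains every transfinite extension of modules in `A`. -/
def ClosedUnderTransfiniteExtensions (A : ObjectProperty (ModuleCat.{u} S)) : Prop :=
  ∀ M : ModuleCat.{u} S, IsTransfiniteExtension A M → A M

/-- `A` is `κ`-deconstructible: every module in `A` is a transfinite extension of `< κ`-presented
modules in `A`. -/
def IsDeconstructibleAt (κ : Cardinal.{u}) (A : ObjectProperty (ModuleCat.{u} S)) : Prop :=
  ∀ M : ModuleCat.{u} S, A M → IsTransfiniteExtension (fun X => A X ∧ IsLTPresented S κ X) M

/-- `A` is `κ`-deconstructible for some infinite cardinal `κ`. -/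
def IsDeconstructible (A : ObjectProperty (ModuleCat.{u} S)) : Prop :=
  ∃ κ : Cardinal.{u}, ℵ₀ ≤ κ ∧ IsDeconstructibleAt κ A

/-- `A` contains every direct summand of a module in `A`. -/
def ClosedUnderDirectSummands (A : ObjectProperty (ModuleCat.{u} S)) : Prop :=
  ∀ M N K : ModuleCat.{u} S, Nonempty (M ≃ₗ[S] N × K) → A M → A N

/-- `A` contains the direct sum of every countable (finite or infinite) family of modules in
`A`. -/
def ClosedUnderCountableDirectSums (A : ObjectProperty (ModuleCat.{u} S)) : Prop :=
  ∀ (ι : Type u) [Countable ι] (G : ι → ModuleCat.{u} S), (∀ i, A (G i)) →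
    A (ModuleCat.of S (⨁ i, G i))

/-- `D` is a `κ`-dense system in `M`: an upward directed family of submodules that is closed under
unions of (nonempty) well-ordered ascending chains of length `< κ` and such that every subset
of `M` of cardinality `< κ` is contained in a member of `D`. -/
structure IsDenseSystem (κ : Cardinal.{u}) {M : Type u} [AddCommGroup M] [Module S M]
    (D : Set (Submodule S M)) : Prop where
  directed : DirectedOn (· ≤ ·) D
  chain : ∀ l : Ordinal.{u}, 0 < l → l < κ.ord → ∀ c : Set.Iio l → Submodule S M,
    Monotone c → (∀ α, c α ∈ D) → (⨆ α, c α) ∈ D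
  cover : ∀ X : Set M, #X < κ → ∃ N ∈ D, X ⊆ (N : Set M)

/-- `M` possesses a `κ`-dense system consisting of modules in `C`. -/
def HasDenseSystem (κ : Cardinal.{u}) (C : ObjectProperty (ModuleCat.{u} S))
    (M : ModuleCat.{u} S) : Prop :=
  ∃ D : Set (Submodule S M), IsDenseSystem κ D ∧ ∀ N ∈ D, C (ModuleCat.of S N)

end Modules

end ModuleClass

/-!
A countable directed set has a cofinal sequence, so let `N` be the limit of a sequence `P`. Fix a
large cardinal `κ` with `κ < κ ^ ℵ₀` and a set `K` of size `κ`, and consider the tree of finite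
sequences in `K`, with a copy of `P n` at each vertex of height `n`. Every branch embeds all `P n`
into the product of these copies, and the images span the tree module `T`. The part of `T` spanned
by countably many branches is a countable direct sum of modules `P n`: a branch is responsible only
for its vertices that lie on no earlier branch. So `T` has an `ℵ₁`-dense system in `A'`, and
`T ∈ A`.

The difference of consecutive embeddings along a branch is concentrated at one vertex, so there are
only `κ` of these differences. By Hill's method they lie in a submodule `L` of `T` of size at most
`κ` with `T ⧸ L ∈ A`. An element of `T` has eventually constant image in `N` along each branch,
with value zero for all but finitely many branches. As there are `κ ^ ℵ₀ > κ` branches, these values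
vanish on `L` along some branch `b`. Then `b` gives a map `T ⧸ L → N`, which is split by the
embeddings along `b`, for these are compatible modulo `L`. Hence `N` is a direct summand of `T ⧸ L`.
-/

namespace ModuleClass

universe v

section Cardinality

variable {κ : Cardinal.{v}}

lemma mk_iUnion_le_of_le {ι : Type w} {α : Type v} {f : ι → Set α} (hκ : ℵ₀ ≤ κ)
    (hι : Cardinal.lift.{v} #ι ≤ Cardinal.lift.{w} κ) (hf : ∀ i, #(f i) ≤ κ) :
    #(⋃ i, f i) ≤ κ := by
  rw [← Cardinal.lift_le.{w}]
  calc Cardinal.lift.{w} #(⋃ i, f i)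
      ≤ Cardinal.lift.{v} #ι * ⨆ i, Cardinal.lift.{w} #(f i) := Cardinal.mk_iUnion_le_lift f
    _ ≤ Cardinal.lift.{w} κ * Cardinal.lift.{w} κ :=
      mul_le_mul' hι (ciSup_le' fun i => Cardinal.lift_le.2 (hf i))
    _ = Cardinal.lift.{w} κ := Cardinal.mul_eq_self (Cardinal.aleph0_le_lift.2 hκ)

lemma mk_finsupp_le {B S : Type v} [Zero S] (hκ : ℵ₀ ≤ κ) (hB : #B ≤ κ) (hS : #S ≤ κ) :
    #(B →₀ S) ≤ κ :=
  calc #(B →₀ S) ≤ #(List (B × S)) :=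
        Cardinal.mk_le_of_injective (f := fun g : B →₀ S => g.graph.toList) fun _ _ h =>
          Finsupp.graph_injective B S <| Finset.val_injective <| by
            simpa only [Finset.coe_toList] using congrArg Multiset.ofList h
    _ ≤ max ℵ₀ #(B × S) := Cardinal.mk_list_le_max _
    _ ≤ κ := max_le hκ (by
        rw [Cardinal.mk_prod, Cardinal.lift_id, Cardinal.lift_id]
        exact Cardinal.mul_le_of_le hκ hB hS)

lemma mk_span_le {S M : Type v} [Ring S] [AddCommGroup M] [Module S M] (hκ : ℵ₀ ≤ κ)
    (hS : #S ≤ κ) {X : Set M} (hX : #X ≤ κ) : #(Submodule.span S X) ≤ κ := by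
  rw [← Subtype.range_coe (s := X), ← Finsupp.range_linearCombination]
  exact (Cardinal.mk_le_of_surjective (LinearMap.surjective_rangeRestrict _)).trans
    (mk_finsupp_le hκ hX hS)

lemma IsLTPresented.mk_le {S M : Type v} [Ring S] [AddCommGroup M] [Module S M]
    {μ : Cardinal.{v}} (h : IsLTPresented S μ M) (hκ : ℵ₀ ≤ κ) (hS : #S ≤ κ) (hμ : μ ≤ κ) :
    #M ≤ κ := by
  obtain ⟨B, p, hB, hp, -⟩ := h
  exact (Cardinal.mk_le_of_surjective hp).trans (mk_finsupp_le hκ (hB.le.trans hμ) hS)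

lemma exists_small_closed_submodule {S M : Type v} [Ring S] [AddCommGroup M] [Module S M]
    (hκ : ℵ₀ ≤ κ) (hS : #S ≤ κ) {c : M → Set M} (hc : ∀ x, #(c x) ≤ κ) {X : Set M}
    (hX : #X ≤ κ) :
    ∃ L : Submodule S M, X ⊆ L ∧ #L ≤ κ ∧ ∀ x ∈ L, c x ⊆ L := by
  let enlarge (N : Submodule S M) : Submodule S M := Submodule.span S (N ∪ ⋃ x : N, c x)
  let L (n : ℕ) : Submodule S M := enlarge^[n] (Submodule.span S X)
  have hLsucc (n : ℕ) : L (n + 1) = enlarge (L n) := Function.iterate_succ_apply' ..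
  have hLmono : Monotone L := monotone_nat_of_le_succ fun n => by
    rw [hLsucc]
    exact fun x hx => Submodule.subset_span (.inl hx)
  have hLcard (n : ℕ) : #(L n) ≤ κ := by
    induction n with
    | zero => exact mk_span_le hκ hS hX
    | succ n ih =>
      rw [hLsucc]
      refine mk_span_le hκ hS ((Cardinal.mk_union_le _ _).trans (Cardinal.add_le_of_le hκ ih ?_))
      exact mk_iUnion_le_of_le hκ (Cardinal.lift_le.2 ih) fun x => hc x
  have hLunion : ((⨆ n, L n : Submodule S M) : Set M) = ⋃ n, L n :=
    Submodule.coe_iSup_of_directed L hLmono.directed_le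
  refine ⟨⨆ n, L n, Submodule.subset_span.trans (le_iSup L 0), ?_, fun x hx => ?_⟩
  · rw [← SetLike.coe_sort_coe, hLunion]
    exact mk_iUnion_le_of_le hκ (by simpa using hκ) hLcard
  · rw [← SetLike.mem_coe, hLunion, Set.mem_iUnion] at hx
    obtain ⟨n, hn⟩ := hx
    refine subset_trans (fun y hy => ?_) (le_iSup L (n + 1))
    rw [hLsucc]
    exact Submodule.subset_span (.inr (Set.mem_iUnion.2 ⟨⟨x, hn⟩, hy⟩))

lemma exists_le_lt_power_aleph0 (c : Cardinal.{v}) :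
    ∃ κ, c ≤ κ ∧ ℵ₀ ≤ κ ∧ κ < κ ^ (ℵ₀ : Cardinal.{v}) := by
  let o : Ordinal.{v} := c.ord + Ordinal.omega0
  have ho : Order.IsSuccLimit o := Ordinal.isSuccLimit_add _ Ordinal.isSuccLimit_omega0
  have hcof : (ℵ_ o).ord.cof = ℵ₀ := by
    rw [Cardinal.ord_aleph, Ordinal.cof_omega ho, Ordinal.cof_add _ Ordinal.omega0_ne_zero,
      Ordinal.cof_omega0]
  refine ⟨ℵ_ o, ?_, Cardinal.aleph0_le_aleph o, ?_⟩
  · simpa using Ordinal.card_le_card (le_self_add.trans (Ordinal.le_omega_self o))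
  · simpa only [hcof] using Cardinal.lt_power_cof_ord (Cardinal.aleph0_le_aleph o)

end Cardinality

section Filtration

variable {S : Type u} [Ring S]

lemma IsTransfiniteExtension.mono {C C' : ObjectProperty (ModuleCat.{u} S)} (h : C ≤ C')
    {M : ModuleCat.{u} S} (hM : IsTransfiniteExtension C M) : IsTransfiniteExtension C' M := by
  obtain ⟨l, F, hF, hfactor⟩ := hM
  refine ⟨l, F, hF, fun α hα => ?_⟩
  obtain ⟨Y, hY, e⟩ := hfactor α hα
  exact ⟨Y, h Y hY, e⟩

lemma ClosedUnderTransfiniteExtensions.of_subsingleton {A : ObjectProperty (ModuleCat.{u} S)}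
    (hA : ClosedUnderTransfiniteExtensions A) (X : ModuleCat.{u} S) [Subsingleton X] : A X :=
  hA X ⟨0, fun _ => ⊥,
    ⟨rfl, fun _ _ _ _ => le_rfl, Subsingleton.elim _ _, fun _ _ _ => by simp only [iSup_bot]⟩,
    fun _ hα => absurd hα not_lt_zero⟩

variable {M N : Type u} [AddCommGroup M] [Module S M] [AddCommGroup N] [Module S N]
  {l : Ordinal.{u}} {F : Ordinal.{u} → Submodule S M}

lemma IsFiltration.map (hF : IsFiltration l F) {φ : M →ₗ[S] N} (hφ : Function.Surjective φ) :
    IsFiltration l fun α => (F α).map φ where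
  zero := by rw [hF.zero, Submodule.map_bot]
  mono α β hαβ hβ := Submodule.map_mono (hF.mono α β hαβ hβ)
  top := by rw [hF.top, Submodule.map_top, LinearMap.range_eq_top.2 hφ]
  limit α hα hlim := by rw [hF.limit α hα hlim, Submodule.map_iSup]

lemma nonempty_map_factor_equiv {φ : M →ₗ[S] N} {P Q : Submodule S M} (hPQ : P ≤ Q)
    (h : LinearMap.ker φ ⊓ Q ≤ P) :
    Nonempty ((↥(Q.map φ) ⧸ (P.map φ).submoduleOf (Q.map φ)) ≃ₗ[S] (↥Q ⧸ P.submoduleOf Q)) := by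
  let ψ : Q →ₗ[S] (↥(Q.map φ) ⧸ (P.map φ).submoduleOf (Q.map φ)) :=
    Submodule.mkQ _ ∘ₗ φ.submoduleMap Q
  have hψ : Function.Surjective ψ :=
    (Submodule.mkQ_surjective _).comp (φ.submoduleMap_surjective Q)
  have hker : LinearMap.ker ψ = P.submoduleOf Q := by
    ext x
    have hx : x ∈ LinearMap.ker ψ ↔ φ x ∈ P.map φ := Submodule.Quotient.mk_eq_zero _
    refine hx.trans ⟨?_, fun hxP => ⟨x, hxP, rfl⟩⟩
    rintro ⟨y, hy, hyx⟩
    have hxy : (x : M) - y ∈ P :=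
      h ⟨LinearMap.sub_mem_ker_iff.2 hyx.symm, sub_mem x.2 (hPQ hy)⟩
    change (x : M) ∈ P
    simpa only [sub_add_cancel] using add_mem hxy hy
  exact ⟨((Submodule.quotEquivOfEq _ _ hker.symm).trans (ψ.quotKerEquivOfSurjective hψ)).symm⟩

lemma exists_le_sup_span_of_mk_factor (P Q : Submodule S M) :
    ∃ Y : Set M, #Y ≤ #(↥Q ⧸ P.submoduleOf Q) ∧ Q ≤ P ⊔ Submodule.span S Y := by
  let rep (q : ↥Q ⧸ P.submoduleOf Q) : M := (q.out : Q)
  refine ⟨Set.range rep, Cardinal.mk_range_le, fun x hx => ?_⟩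
  let q : ↥Q ⧸ P.submoduleOf Q := Submodule.Quotient.mk ⟨x, hx⟩
  have hq : x - rep q ∈ P := (Submodule.Quotient.eq (P.submoduleOf Q)).1 (Quotient.out_eq q).symm
  rw [← sub_add_cancel x (rep q)]
  exact Submodule.add_mem_sup hq (Submodule.subset_span ⟨q, rfl⟩)

lemma IsFiltration.eq_of_mem_succ_of_notMem (hF : IsFiltration l F) {x : M} {α β : Ordinal.{u}}
    (hα : α < l) (hβ : β < l) (hxα : x ∈ F (Order.succ α)) (hxα' : x ∉ F α)
    (hxβ : x ∈ F (Order.succ β)) (hxβ' : x ∉ F β) : α = β := by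
  rcases lt_trichotomy α β with h | h | h
  · exact absurd (hF.mono _ _ (Order.succ_le_of_lt h) hβ.le hxα) hxβ'
  · exact h
  · exact absurd (hF.mono _ _ (Order.succ_le_of_lt h) hα.le hxβ) hxα'

lemma IsFiltration.exists_small_jump_generators {κ : Cardinal.{u}} (hF : IsFiltration l F)
    (hsmall : ∀ α < l, #(↥(F (Order.succ α)) ⧸ (F α).submoduleOf (F (Order.succ α))) ≤ κ)
    (x : M) :
    ∃ Y : Set M, #Y ≤ κ ∧ ∀ α < l, x ∈ F (Order.succ α) → x ∉ F α →
      F (Order.succ α) ≤ F α ⊔ Submodule.span S Y := by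
  by_cases hx : ∃ α < l, x ∈ F (Order.succ α) ∧ x ∉ F α
  · obtain ⟨α, hα, hxα, hxα'⟩ := hx
    obtain ⟨Y, hYcard, hY⟩ := exists_le_sup_span_of_mk_factor (F α) (F (Order.succ α))
    refine ⟨Y, hYcard.trans (hsmall α hα), fun β hβ hxβ hxβ' => ?_⟩
    obtain rfl := hF.eq_of_mem_succ_of_notMem hα hβ hxα hxα' hxβ hxβ'
    exact hY
  · exact ⟨∅, by simp, fun α hα hxα hxα' => absurd ⟨α, hα, hxα, hxα'⟩ hx⟩

/- If `L` contains, with every `x` that first appears in `F (α + 1)`, generators of `F (α + 1)`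
over `F α`, then `L` either avoids `F (α + 1) \ F α`, so that the factor survives in `M ⧸ L`,
or absorbs the whole factor. -/
lemma exists_small_submodule_quotient_isTransfiniteExtension {κ : Cardinal.{u}} (hκ : ℵ₀ ≤ κ)
    (hS : #S ≤ κ) {C : ObjectProperty (ModuleCat.{u} S)} (hC : ∀ Y, C Y → #Y ≤ κ)
    (hC₀ : C (ModuleCat.of S PUnit)) {M : ModuleCat.{u} S} (hM : IsTransfiniteExtension C M)
    {X : Set M} (hX : #X ≤ κ) :
    ∃ L : Submodule S M, X ⊆ L ∧ #L ≤ κ ∧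
      IsTransfiniteExtension C (ModuleCat.of S (M ⧸ L)) := by
  obtain ⟨l, F, hF, hfactor⟩ := hM
  have hsmall (α) (hα : α < l) :
      #(↥(F (Order.succ α)) ⧸ (F α).submoduleOf (F (Order.succ α))) ≤ κ := by
    obtain ⟨Y, hY, ⟨e⟩⟩ := hfactor α hα
    exact (Cardinal.mk_congr e.toEquiv).trans_le (hC Y hY)
  choose c hccard hc using hF.exists_small_jump_generators hsmall
  obtain ⟨L, hXL, hLcard, hcL⟩ := exists_small_closed_submodule hκ hS hccard hX
  refine ⟨L, hXL, hLcard, l, _, hF.map L.mkQ_surjective, fun α hα => ?_⟩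
  by_cases havoid : L ⊓ F (Order.succ α) ≤ F α
  · obtain ⟨Y, hY, ⟨e⟩⟩ := hfactor α hα
    obtain ⟨e'⟩ := nonempty_map_factor_equiv (φ := L.mkQ)
      (hF.mono _ _ (Order.le_succ α) (Order.succ_le_of_lt hα)) (by rwa [L.ker_mkQ])
    exact ⟨Y, hY, ⟨e'.trans e⟩⟩
  · obtain ⟨x, ⟨hxL, hxα⟩, hxα'⟩ := SetLike.not_le_iff_exists.1 havoid
    have habsorb : F (Order.succ α) ≤ F α ⊔ L :=
      (hc x α hα hxα hxα').trans (sup_le_sup_left (Submodule.span_le.2 (hcL x hxL)) _)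
    have hmap : (F (Order.succ α)).map L.mkQ ≤ (F α).map L.mkQ := by
      simpa only [Submodule.map_sup, Submodule.mkQ_map_self, sup_bot_eq] using
        Submodule.map_mono (f := L.mkQ) habsorb
    have : Subsingleton (↥((F (Order.succ α)).map L.mkQ) ⧸
        ((F α).map L.mkQ).submoduleOf ((F (Order.succ α)).map L.mkQ)) :=
      Submodule.Quotient.subsingleton_iff.2 (Submodule.submoduleOf_eq_top.2 hmap)
    exact ⟨_, hC₀, ⟨LinearEquiv.ofSubsingleton _ _⟩⟩

end Filtration

section DenseSystem

variable {S M : Type u} [Ring S] [AddCommGroup M] [Module S M]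

lemma isDenseSystem_biSup_countable {J : Type*} {V : J → Submodule S M} (hV : ⨆ j, V j = ⊤) :
    IsDenseSystem (ℵ_ 1) ((fun B : Set J => ⨆ j ∈ B, V j) '' {B | B.Countable}) where
  directed := by
    rintro _ ⟨B, hB, rfl⟩ _ ⟨B', hB', rfl⟩
    exact ⟨_, ⟨B ∪ B', hB.union hB', rfl⟩, biSup_mono fun _ => .inl, biSup_mono fun _ => .inr⟩
  chain l _ hl c _ hc := by
    have : Countable (Set.Iio l) := by
      rw [← Cardinal.mk_le_aleph0_iff, Cardinal.mk_Iio_ordinal, Cardinal.lift_le_aleph0,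
        ← Cardinal.lt_aleph_one_iff]
      exact Cardinal.lt_ord.1 hl
    choose B hB hBc using hc
    refine ⟨⋃ α, B α, Set.countable_iUnion hB, ?_⟩
    rw [← iSup_congr hBc]
    exact iSup_iUnion B V
  cover X hX := by
    have : Countable X := by
      rwa [← Cardinal.mk_le_aleph0_iff, ← Cardinal.lt_aleph_one_iff]
    have hfinset (x : M) : ∃ s : Finset J, x ∈ ⨆ j ∈ s, V j :=
      Submodule.mem_iSup_iff_exists_finset.1 (hV ▸ Submodule.mem_top)
    choose s hs using hfinset
    refine ⟨_, ⟨⋃ x : X, s x, Set.countable_iUnion fun x => (s x).countable_toSet, rfl⟩,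
      fun x hx => ?_⟩
    have hle : ⨆ j ∈ s x, V j ≤ ⨆ j ∈ ⋃ x : X, (s x : Set J), V j :=
      biSup_mono fun j hj => Set.mem_iUnion.2 ⟨⟨x, hx⟩, hj⟩
    exact hle (hs x)

end DenseSystem

section Branches

open Filter

variable {K : Type*} {b b' : ℕ → K} {n m : ℕ}

/-- The vertex at height `n` of the branch `b`, in the tree of finite sequences in `K`. The height
is kept apart from the sequence, so that a family of modules indexed by the vertices is a dependent
function of the two. -/
def node (b : ℕ → K) (n : ℕ) : Fin n → K := fun i => b i

lemma node_eq_node_iff : node b n = node b' n ↔ ∀ i < n, b i = b' i :=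
  funext_iff.trans Fin.forall_iff

lemma node_eq_node_of_le (h : n ≤ m) (hb : node b m = node b' m) : node b n = node b' n :=
  node_eq_node_iff.2 fun i hi => node_eq_node_iff.1 hb i (hi.trans_le h)

lemma eventually_node_ne_node (h : b ≠ b') : ∀ᶠ n in atTop, node b n ≠ node b' n := by
  obtain ⟨i, hi⟩ := Function.ne_iff.1 h
  filter_upwards [eventually_gt_atTop i] with n hn hnode
  exact hi (node_eq_node_iff.1 hnode i hn)

/-- `b` has the least rank among the branches in `B` through its vertex at height `n`. Vertices
that lie on branches in `B` are thus represented by leaders, in a way compatible with going up. -/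
structure IsLeader (rank : (ℕ → K) → ℕ) (B : Set (ℕ → K)) (b : ℕ → K) (n : ℕ) : Prop where
  mem : b ∈ B
  rank_le : ∀ b' ∈ B, node b' n = node b n → rank b ≤ rank b'

variable {rank : (ℕ → K) → ℕ} {B : Set (ℕ → K)}

lemma IsLeader.mono (hb : IsLeader rank B b n) (h : n ≤ m) : IsLeader rank B b m :=
  ⟨hb.mem, fun b' hb' hnode => hb.rank_le b' hb' (node_eq_node_of_le h hnode)⟩

lemma IsLeader.eq (hrank : Set.InjOn rank B) (hb : IsLeader rank B b n)
    (hb' : IsLeader rank B b' n) (h : node b n = node b' n) : b = b' :=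
  hrank hb.mem hb'.mem (le_antisymm (hb.rank_le b' hb'.mem h.symm) (hb'.rank_le b hb.mem h))

lemma exists_isLeader (rank : (ℕ → K) → ℕ) (hb : b ∈ B) (n : ℕ) :
    ∃ b', IsLeader rank B b' n ∧ node b' n = node b n := by
  obtain ⟨b', hmin⟩ := exists_minimalFor_of_wellFoundedLT
    (fun b' => b' ∈ B ∧ node b' n = node b n) rank ⟨b, hb, rfl⟩
  obtain ⟨hb', hnode⟩ := hmin.prop
  exact ⟨b', ⟨hb', fun b'' hb'' h => hmin.le ⟨hb'', h.trans hnode⟩⟩, hnode⟩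

lemma eventually_isLeader (hrank : Set.InjOn rank B) (hb : b ∈ B) :
    ∀ᶠ n in atTop, IsLeader rank B b n := by
  have hfin : {b' ∈ B | rank b' < rank b}.Finite :=
    .of_finite_image ((Set.finite_Iio (rank b)).subset (by rintro _ ⟨b', hb', rfl⟩; exact hb'.2))
      (hrank.mono (Set.sep_subset _ _))
  have hne : ∀ᶠ n in atTop, ∀ b' ∈ {b' ∈ B | rank b' < rank b}, node b' n ≠ node b n :=
    (eventually_all_finite hfin).2 fun b' hb' =>
      eventually_node_ne_node (ne_of_apply_ne rank hb'.2.ne)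
  filter_upwards [hne] with n hn
  exact ⟨hb, fun b' hb' hnode => not_lt.1 fun hlt => hn b' ⟨hb', hlt⟩ hnode⟩

end Branches

section DirectSum

variable {S ι M : Type*} [Ring S] {Q : ι → Type*} [∀ i, AddCommGroup (Q i)] [∀ i, Module S (Q i)]
  [AddCommGroup M] [Module S M] [DecidableEq ι]

lemma range_toModule (φ : ∀ i, Q i →ₗ[S] M) :
    LinearMap.range (DirectSum.toModule S ι M φ) = ⨆ i, LinearMap.range (φ i) := by
  rw [LinearMap.range_eq_map, ← DFinsupp.iSup_range_lsingle, Submodule.map_iSup]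
  refine iSup_congr fun i => ?_
  rw [← LinearMap.range_comp]
  exact congrArg LinearMap.range (LinearMap.ext fun x => DirectSum.toModule_lof S i x)

lemma toModule_apply_eq_sum [∀ i (x : Q i), Decidable (x ≠ 0)] (φ : ∀ i, Q i →ₗ[S] M)
    (x : ⨁ i, Q i) : DirectSum.toModule S ι M φ x = ∑ i ∈ DFinsupp.support x, φ i (x i) := by
  conv_lhs => rw [← DirectSum.sum_support_of x]
  exact (map_sum _ _ _).trans (Finset.sum_congr rfl fun i _ => DirectSum.toModule_lof S i (x i))

end DirectSum

section TreeModule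

open Filter

variable {S : Type*} [Ring S] {K : Type u} {P : ℕ → Type v} [∀ n, AddCommGroup (P n)]
  [∀ n, Module S (P n)] (f : ∀ n m, n ≤ m → P n →ₗ[S] P m) {b b' : ℕ → K} {n m : ℕ}

open Classical in
/-- The embedding of `P n` into the product of copies of the modules `P m`, one for each vertex of
height `m`, along the part of the branch `b` from height `n` on. -/
noncomputable def branchMap (b : ℕ → K) (n : ℕ) : P n →ₗ[S] ∀ m, (Fin m → K) → P m :=
  LinearMap.pi fun m =>
    if h : n ≤ m then LinearMap.single S (fun _ => P m) (node b m) ∘ₗ f n m h else 0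

lemma branchMap_apply_node (h : n ≤ m) (x : P n) :
    branchMap f b n x m (node b m) = f n m h x := by
  classical
  simp only [branchMap, LinearMap.pi_apply, dif_pos h, LinearMap.comp_apply,
    LinearMap.single_apply, Pi.single_eq_same]

lemma branchMap_apply_of_lt (h : m < n) (x : P n) : branchMap f b n x m = 0 := by
  simp only [branchMap, LinearMap.pi_apply, dif_neg h.not_ge, LinearMap.zero_apply]

lemma branchMap_apply_of_ne {σ : Fin m → K} (h : σ ≠ node b m) (x : P n) :
    branchMap f b n x m σ = 0 := by
  classical
  rcases le_or_gt n m with hnm | hmn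
  · simp only [branchMap, LinearMap.pi_apply, dif_pos hnm, LinearMap.comp_apply,
      LinearMap.single_apply, Pi.single_eq_of_ne h]
  · rw [branchMap_apply_of_lt f hmn, Pi.zero_apply]

variable (K) in
/-- The tree module of the sequence `P`: the span of the images of all branches. -/
noncomputable def treeModule : Submodule S (∀ m, (Fin m → K) → P m) :=
  ⨆ b : ℕ → K, ⨆ n, LinearMap.range (branchMap f b n)

lemma branchMap_mem_treeModule (b : ℕ → K) (n : ℕ) (x : P n) :
    branchMap f b n x ∈ treeModule K f :=
  Submodule.mem_iSup_of_mem b (Submodule.mem_iSup_of_mem n ⟨x, rfl⟩)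

/-- `branchMap` with values in the tree module. -/
noncomputable def branch (b : ℕ → K) (n : ℕ) : P n →ₗ[S] treeModule K f :=
  (branchMap f b n).codRestrict _ (branchMap_mem_treeModule f b n)

/-- The submodule of the tree module contributed by the branch `b`. -/
noncomputable def branchSpan (b : ℕ → K) : Submodule S (treeModule K f) :=
  ⨆ n, LinearMap.range (branch f b n)

lemma iSup_branchSpan : ⨆ b : ℕ → K, branchSpan f b = ⊤ := by
  refine Submodule.map_injective_of_injective (treeModule K f).subtype_injective ?_
  simp only [branchSpan, Submodule.map_iSup, ← LinearMap.range_comp, branch,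
    LinearMap.subtype_comp_codRestrict, Submodule.map_top, Submodule.range_subtype]
  rfl

lemma eq_top_of_branch_mem {W : Submodule S (treeModule K f)}
    (hW : ∀ b n x, branch f b n x ∈ W) : W = ⊤ := by
  refine top_unique ((iSup_branchSpan f).ge.trans (iSup_le fun b => iSup_le fun n => ?_))
  rintro _ ⟨x, rfl⟩
  exact hW b n x

/-- The difference of two consecutive embeddings along a branch. It is concentrated at one
vertex, and so it depends only on that vertex. -/
noncomputable def branchDiff (b : ℕ → K) (n : ℕ) : P n →ₗ[S] treeModule K f :=
  branch f b n - branch f b (n + 1) ∘ₗ f n (n + 1) n.le_succ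

section DirectedSystem

variable [DirectedSystem P (f · · ·)]

open Classical in
lemma coe_branchDiff_apply (b : ℕ → K) (n : ℕ) (x : P n) :
    (branchDiff f b n x : ∀ m, (Fin m → K) → P m) = Pi.single n (Pi.single (node b n) x) := by
  funext m σ
  change branchMap f b n x m σ - branchMap f b (n + 1) (f n (n + 1) n.le_succ x) m σ = _
  by_cases hσ : σ = node b m
  · subst hσ
    rcases lt_trichotomy n m with h | rfl | h
    · rw [branchMap_apply_node f h.le, branchMap_apply_node f h, DirectedSystem.map_map' f,
        sub_self, Pi.single_eq_of_ne h.ne', Pi.zero_apply]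
    · rw [branchMap_apply_node f le_rfl, branchMap_apply_of_lt f n.lt_succ_self,
        DirectedSystem.map_self' f, Pi.zero_apply, sub_zero, Pi.single_eq_same, Pi.single_eq_same]
    · rw [branchMap_apply_of_lt f h, branchMap_apply_of_lt f (h.trans n.lt_succ_self),
        Pi.single_eq_of_ne h.ne, sub_self, Pi.zero_apply]
  · rw [branchMap_apply_of_ne f hσ, branchMap_apply_of_ne f hσ, sub_zero]
    rcases eq_or_ne m n with rfl | h
    · rw [Pi.single_eq_same, Pi.single_eq_of_ne hσ]
    · rw [Pi.single_eq_of_ne h, Pi.zero_apply]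

lemma branchDiff_congr (h : node b n = node b' n) : branchDiff f b n = branchDiff f b' n := by
  classical
  refine LinearMap.ext fun x => Subtype.ext ?_
  rw [coe_branchDiff_apply, coe_branchDiff_apply, h]

variable {f}

lemma branch_sub_branch_mem {L : Submodule S (treeModule K f)}
    (hL : ∀ n x, branchDiff f b n x ∈ L) (h : n ≤ m) (x : P n) :
    branch f b n x - branch f b m (f n m h x) ∈ L := by
  induction m, h using Nat.le_induction with
  | base => rw [DirectedSystem.map_self' f, sub_self]; exact zero_mem L
  | succ m h ih =>
    have hdiff : branch f b m (f n m h x) - branch f b (m + 1) (f n (m + 1) (h.trans m.le_succ) x)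
        = branchDiff f b m (f n m h x) := by
      rw [← DirectedSystem.map_map' f h m.le_succ]; rfl
    rw [← sub_add_sub_cancel _ (branch f b m (f n m h x)), hdiff]
    exact add_mem ih (hL m _)

variable {rank : (ℕ → K) → ℕ} {B : Set (ℕ → K)}

lemma branch_mem_of_isLeader (hrank : Set.InjOn rank B) {W : Submodule S (treeModule K f)}
    (hW : ∀ b n, IsLeader rank B b n → ∀ x, branch f b n x ∈ W) (hb : b ∈ B) (x : P n) :
    branch f b n x ∈ W := by
  have hdiff (n) (x : P n) : branchDiff f b n x ∈ W := by
    obtain ⟨b', hb', hnode⟩ := exists_isLeader rank hb n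
    rw [← branchDiff_congr f hnode]
    exact sub_mem (hW b' n hb' x) (hW b' (n + 1) (hb'.mono n.le_succ) _)
  obtain ⟨m, hm, hnm⟩ := ((eventually_isLeader hrank hb).and (eventually_ge_atTop n)).exists
  simpa only [sub_add_cancel] using add_mem (branch_sub_branch_mem hdiff hnm x)
    (hW b m hm (f n m hnm x))

lemma injective_toModule_branch {ι : Type*} [DecidableEq ι] {β : ι → ℕ → K} {d : ι → ℕ}
    (h : ∀ i j, d i = d j → node (β i) (d i) = node (β j) (d i) → i = j) :
    Function.Injective (DirectSum.toModule S ι _ fun i => branch f (β i) (d i)) := by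
  classical
  refine (injective_iff_map_eq_zero _).2 fun x hx => DFinsupp.support_eq_empty.1 ?_
  by_contra hne
  obtain ⟨i, hi, hmin⟩ := Finset.exists_min_image _ d (Finset.nonempty_iff_ne_empty.2 hne)
  let coord : treeModule K f →ₗ[S] P (d i) :=
    LinearMap.proj (node (β i) (d i)) ∘ₗ LinearMap.proj (d i) ∘ₗ (treeModule K f).subtype
  have hother (j) (hj : j ∈ DFinsupp.support x) (hji : j ≠ i) :
      coord (branch f (β j) (d j) (x j)) = 0 := by
    change branchMap f (β j) (d j) (x j) (d i) (node (β i) (d i)) = 0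
    rcases (hmin j hj).lt_or_eq with hlt | heq
    · rw [branchMap_apply_of_lt f hlt, Pi.zero_apply]
    · exact branchMap_apply_of_ne f (fun hnode => hji (h i j heq hnode).symm) _
  have hsame : coord (branch f (β i) (d i) (x i)) = x i :=
    (branchMap_apply_node f le_rfl _).trans (DirectedSystem.map_self' f _)
  have hsum : ∑ j ∈ DFinsupp.support x, coord (branch f (β j) (d j) (x j)) = 0 := by
    rw [toModule_apply_eq_sum] at hx
    exact (map_sum coord _ _).symm.trans ((congrArg coord hx).trans (map_zero coord))
  rw [Finset.sum_eq_single_of_mem i hi hother, hsame] at hsum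
  exact DFinsupp.mem_support_iff.1 hi hsum

lemma exists_directSum_equiv_biSup_branchSpan (hB : B.Countable) :
    ∃ ι : Type u, Countable ι ∧ ∃ d : ι → ℕ,
      Nonempty ((⨁ i, P (d i)) ≃ₗ[S] ↥(⨆ b ∈ B, branchSpan f b)) := by
  classical
  obtain ⟨rank, hrank⟩ := Set.countable_iff_exists_injOn.1 hB
  let ι := {p : (ℕ → K) × ℕ // IsLeader rank B p.1 p.2}
  have hι : Countable ι := by
    have hsub : {p : (ℕ → K) × ℕ | IsLeader rank B p.1 p.2} ⊆ B ×ˢ Set.univ :=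
      fun p hp => ⟨hp.mem, trivial⟩
    exact ((hB.prod Set.countable_univ).mono hsub).to_subtype
  let Φ := DirectSum.toModule S ι _ fun i => branch f i.1.1 i.1.2
  have hinj : Function.Injective Φ := injective_toModule_branch fun i j hd hnode => by
    have hj : IsLeader rank B j.1.1 i.1.2 := hd ▸ j.2
    exact Subtype.ext (Prod.ext (i.2.eq hrank hj hnode) hd)
  have hrange : LinearMap.range Φ = ⨆ b ∈ B, branchSpan f b := by
    rw [range_toModule]
    refine le_antisymm (iSup_le fun i => ?_) (iSup₂_le fun b hb => iSup_le fun n => ?_)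
    · exact (le_iSup (fun n => LinearMap.range (branch f i.1.1 n)) i.1.2).trans
        (le_biSup (branchSpan f) i.2.mem)
    · rintro _ ⟨x, rfl⟩
      refine branch_mem_of_isLeader hrank (fun b n hb x => ?_) hb x
      exact Submodule.mem_iSup_of_mem (⟨(b, n), hb⟩ : ι) ⟨x, rfl⟩
  exact ⟨ι, hι, fun i => i.1.2, ⟨(LinearEquiv.ofInjective Φ hinj).trans (.ofEq _ _ hrange)⟩⟩

end DirectedSystem

section BranchLimit

/-- The embedding of a module into the germs at infinity of sequences in it, as constant
sequences. -/
noncomputable def constGerm (S N : Type*) [Ring S] [AddCommGroup N] [Module S N] :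
    N →ₗ[S] Germ (atTop : Filter ℕ) N where
  toFun y := (y : Germ atTop N)
  map_add' _ _ := rfl
  map_smul' _ _ := rfl

lemma constGerm_injective (S N : Type*) [Ring S] [AddCommGroup N] [Module S N] :
    Function.Injective (constGerm S N) := fun _ _ => Germ.const_inj.1

/-- The sequence of the coordinates of an element of the tree module along the branch `b`, mapped
to the direct limit, as a germ at infinity. -/
noncomputable def branchGerm (b : ℕ → K) :
    treeModule K f →ₗ[S] Germ (atTop : Filter ℕ) (Module.DirectLimit P f) where
  toFun t := ((fun m => Module.DirectLimit.of S ℕ P f m (t.1 m (node b m)) :) : Germ atTop _)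
  map_add' _ _ := congrArg Germ.ofFun (funext fun _ => map_add _ _ _)
  map_smul' _ _ := congrArg Germ.ofFun (funext fun _ => map_smul _ _ _)

lemma branchGerm_branch (b : ℕ → K) (n : ℕ) (x : P n) :
    branchGerm f b (branch f b n x) = constGerm S _ (Module.DirectLimit.of S ℕ P f n x) := by
  refine Germ.coe_eq.2 ?_
  filter_upwards [eventually_ge_atTop n] with m hnm
  exact (congrArg _ (branchMap_apply_node f hnm x)).trans Module.DirectLimit.of_f

lemma branchGerm_branch_of_ne (h : b' ≠ b) (n : ℕ) (x : P n) :
    branchGerm f b' (branch f b n x) = 0 := by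
  refine Germ.coe_eq.2 ?_
  filter_upwards [eventually_node_ne_node h] with m hm
  exact (congrArg _ (branchMap_apply_of_ne f hm x)).trans (map_zero _)

lemma branchGerm_mem_range_constGerm (b : ℕ → K) (t : treeModule K f) :
    branchGerm f b t ∈ LinearMap.range (constGerm S (Module.DirectLimit P f)) := by
  let W := (LinearMap.range (constGerm S (Module.DirectLimit P f))).comap (branchGerm f b)
  have htop : W = ⊤ := eq_top_of_branch_mem f fun b' n x => by
    rcases eq_or_ne b b' with rfl | h
    · exact ⟨_, (branchGerm_branch f b n x).symm⟩
    · exact ⟨0, (map_zero _).trans (branchGerm_branch_of_ne f h n x).symm⟩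
  exact (htop ▸ Submodule.mem_top : t ∈ W)

/-- The eventual value, in the direct limit, of the coordinates along the branch `b`. -/
noncomputable def branchLimit (b : ℕ → K) : treeModule K f →ₗ[S] Module.DirectLimit P f :=
  (LinearEquiv.ofInjective (constGerm S (Module.DirectLimit P f))
      (constGerm_injective S _)).symm.toLinearMap ∘ₗ
    (branchGerm f b).codRestrict _ (branchGerm_mem_range_constGerm f b)

lemma constGerm_branchLimit (b : ℕ → K) (t : treeModule K f) :
    constGerm S _ (branchLimit f b t) = branchGerm f b t :=
  congrArg Subtype.val (LinearEquiv.apply_symm_apply (.ofInjective _ (constGerm_injective S _))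
    (⟨branchGerm f b t, branchGerm_mem_range_constGerm f b t⟩ : LinearMap.range (constGerm S _)))

lemma branchLimit_branch (b : ℕ → K) (n : ℕ) (x : P n) :
    branchLimit f b (branch f b n x) = Module.DirectLimit.of S ℕ P f n x :=
  constGerm_injective S _ (by rw [constGerm_branchLimit, branchGerm_branch])

lemma branchLimit_branch_of_ne (h : b' ≠ b) (n : ℕ) (x : P n) :
    branchLimit f b' (branch f b n x) = 0 :=
  constGerm_injective S _ (by rw [constGerm_branchLimit, branchGerm_branch_of_ne f h, map_zero])

lemma finite_support_branchLimit (t : treeModule K f) :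
    (Function.support fun b => branchLimit f b t).Finite := by
  let W : Submodule S (treeModule K f) :=
    (LinearMap.range Finsupp.lcoeFun).comap (LinearMap.pi (branchLimit f))
  have htop : W = ⊤ := eq_top_of_branch_mem f fun b n x => by
    refine ⟨Finsupp.single b (Module.DirectLimit.of S ℕ P f n x), funext fun b' => ?_⟩
    rcases eq_or_ne b' b with rfl | h
    · exact Finsupp.single_eq_same.trans (branchLimit_branch f b' n x).symm
    · exact (Finsupp.single_eq_of_ne h).trans (branchLimit_branch_of_ne f h n x).symm
  obtain ⟨g, hg⟩ : t ∈ W := htop ▸ Submodule.mem_top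
  exact g.hasFiniteSupport.subset (congrArg Function.support hg).ge

variable {f}

lemma exists_branchLimit_eq_zero {κ : Cardinal.{u}} (hκ : ℵ₀ ≤ κ) (L : Set (treeModule K f))
    (hL : Cardinal.lift.{u} #L ≤ Cardinal.lift.{max u v} κ) (hK : κ < #(ℕ → K)) :
    ∃ b : ℕ → K, ∀ t ∈ L, branchLimit f b t = 0 := by
  have hcard : #(⋃ t : L, Function.support fun b => branchLimit f b t.1) ≤ κ :=
    mk_iUnion_le_of_le hκ hL fun t =>
      (Cardinal.lt_aleph0_iff_finite.2 (finite_support_branchLimit f t.1)).le.trans hκ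
  have hne : (⋃ t : L, Function.support fun b => branchLimit f b t.1) ≠ Set.univ := fun h => by
    rw [h, Cardinal.mk_univ] at hcard
    exact hK.not_ge hcard
  obtain ⟨b, hb⟩ := (Set.ne_univ_iff_exists_notMem _).1 hne
  exact ⟨b, fun t ht => not_not.1 fun h => hb (Set.mem_iUnion.2 ⟨⟨t, ht⟩, h⟩)⟩

lemma exists_quotient_treeModule_equiv_directLimit_prod [DirectedSystem P (f · · ·)]
    {L : Submodule S (treeModule K f)} (hL : ∀ n x, branchDiff f b n x ∈ L)
    (hb : ∀ t ∈ L, branchLimit f b t = 0) :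
    ∃ p : (treeModule K f ⧸ L) →ₗ[S] Module.DirectLimit P f,
      Nonempty ((treeModule K f ⧸ L) ≃ₗ[S] Module.DirectLimit P f × LinearMap.ker p) := by
  let p := L.liftQ (branchLimit f b) hb
  let s : Module.DirectLimit P f →ₗ[S] treeModule K f ⧸ L :=
    Module.DirectLimit.lift S ℕ P f (fun n => L.mkQ ∘ₗ branch f b n) fun n m h x =>
      ((Submodule.Quotient.eq L).2 (branch_sub_branch_mem hL h x)).symm
  have hps : p ∘ₗ s = LinearMap.id := Module.DirectLimit.hom_ext fun n => LinearMap.ext fun x => by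
    have hs : s (Module.DirectLimit.of S ℕ P f n x) = L.mkQ (branch f b n x) :=
      Module.DirectLimit.lift_of _ _ x
    exact (congrArg p hs).trans (branchLimit_branch f b n x)
  exact ⟨p, ⟨(lequivProdOfRightSplitExact (LinearMap.ker p).injective_subtype
    (Submodule.range_subtype _) hps).symm.trans (LinearEquiv.prodComm S _ _)⟩⟩

end BranchLimit

end TreeModule

section Sequential

variable {S : Type u} [Ring S] {P : ℕ → Type u} [∀ n, AddCommGroup (P n)] [∀ n, Module S (P n)]
  {f : ∀ n m, n ≤ m → P n →ₗ[S] P m} [DirectedSystem P (f · · ·)]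

lemma treeModule_hasDenseSystem (K : Type u) {C : ObjectProperty (ModuleCat.{u} S)}
    [C.IsClosedUnderIsomorphisms]
    (hC : ∀ (ι : Type u) [Countable ι] (d : ι → ℕ), C (ModuleCat.of S (⨁ i, P (d i)))) :
    HasDenseSystem (ℵ_ 1) C (ModuleCat.of S (treeModule K f)) := by
  refine ⟨_, isDenseSystem_biSup_countable (iSup_branchSpan f), ?_⟩
  rintro _ ⟨B, hB, rfl⟩
  obtain ⟨ι, hι, d, ⟨e⟩⟩ := exists_directSum_equiv_biSup_branchSpan (f := f) hB
  exact C.prop_of_iso e.toModuleIso (hC ι d)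

lemma mk_branchDiff_le {K : Type u} {κ : Cardinal.{u}} (hκ : ℵ₀ ≤ κ) (hK : #K ≤ κ)
    (hP : ∀ n, #(P n) ≤ κ) :
    #{t : treeModule K f | ∃ b n x, branchDiff f b n x = t} ≤ κ := by
  classical
  let single (n : ℕ) (p : (Fin n → K) × P n) : ∀ m, (Fin m → K) → P m :=
    Pi.single n (Pi.single p.1 p.2)
  have hsub : {t : treeModule K f | ∃ b n x, branchDiff f b n x = t} ⊆
      Subtype.val ⁻¹' ⋃ n, Set.range (single n) := by
    rintro _ ⟨b, n, x, rfl⟩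
    exact Set.mem_iUnion.2 ⟨n, (node b n, x), (coe_branchDiff_apply f b n x).symm⟩
  have hrange (n : ℕ) : #(Set.range (single n)) ≤ κ := by
    refine Cardinal.mk_range_le.trans ?_
    rw [Cardinal.mk_prod, Cardinal.lift_id, Cardinal.lift_id]
    refine Cardinal.mul_le_of_le hκ ?_ (hP n)
    simpa using (Cardinal.power_le_power_right hK).trans (Cardinal.power_nat_le hκ (n := n))
  exact (Cardinal.mk_le_mk_of_subset hsub).trans <|
    (Cardinal.mk_preimage_of_injective _ _ Subtype.val_injective).trans <|
      mk_iUnion_le_of_le hκ (by simpa using hκ) hrange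

theorem directLimit_nat_mem {A' A : ObjectProperty (ModuleCat.{u} S)}
    [A'.IsClosedUnderIsomorphisms] (hsum : ClosedUnderCountableDirectSums A')
    (hdec : IsDeconstructible A) (htrans : ClosedUnderTransfiniteExtensions A)
    (hsummand : ClosedUnderDirectSummands A)
    (hdense : ∀ M : ModuleCat.{u} S, HasDenseSystem (ℵ_ 1) A' M → A M)
    (hP : ∀ n, A' (ModuleCat.of S (P n))) :
    A (ModuleCat.of S (Module.DirectLimit P f)) := by
  obtain ⟨μ, -, hμ⟩ := hdec
  obtain ⟨κ, hle, hκ, hκω⟩ := exists_le_lt_power_aleph0 (max (max #S μ) #(Σ n, P n))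
  obtain ⟨⟨hSκ, hμκ⟩, hPκ⟩ := (max_le_iff.1 hle).imp_left max_le_iff.1
  let T : ModuleCat.{u} S := ModuleCat.of S (treeModule κ.out f)
  have hT : IsTransfiniteExtension (fun X => A X ∧ #X ≤ κ) T :=
    (hμ T (hdense T (treeModule_hasDenseSystem κ.out fun ι _ d =>
      hsum ι (fun i => .of S (P (d i))) fun i => hP (d i)))).mono
        fun X hX => ⟨hX.1, hX.2.mk_le hκ hSκ hμκ⟩
  obtain ⟨L, hdiff, hLκ, hquot⟩ := exists_small_submodule_quotient_isTransfiniteExtension hκ hSκ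
    (fun _ hX => hX.2)
    ⟨htrans.of_subsingleton _, by simpa using hκ.trans' Cardinal.one_le_aleph0⟩ hT
    (mk_branchDiff_le (f := f) hκ (Cardinal.mk_out κ).le fun n =>
      (Cardinal.mk_le_of_injective sigma_mk_injective).trans hPκ)
  obtain ⟨b, hb⟩ := exists_branchLimit_eq_zero hκ (L : Set (treeModule κ.out f))
    (Cardinal.lift_le.2 hLκ) (by simpa using hκω)
  obtain ⟨p, hp⟩ := exists_quotient_treeModule_equiv_directLimit_prod
    (fun n x => hdiff ⟨b, n, x, rfl⟩) hb
  exact hsummand (.of S _) _ (.of S (LinearMap.ker p)) hp (htrans _ (hquot.mono fun _ hX => hX.1))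

end Sequential

section Cofinal

variable {S I J : Type*} [Ring S] [Preorder I] [Preorder J]
  {G : I → Type*} [∀ i, AddCommGroup (G i)] [∀ i, Module S (G i)]
  (f : ∀ i j, i ≤ j → G i →ₗ[S] G j) [DirectedSystem G (f · · ·)] {s : J → I}

lemma directedSystem_comp (hs : Monotone s) :
    DirectedSystem (fun j => G (s j)) fun _ _ h => f _ _ (hs h) where
  map_self _ x := DirectedSystem.map_self' f x
  map_map _ _ _ h h' x := DirectedSystem.map_map' f (hs h) (hs h') x

variable [DecidableEq I] [DecidableEq J] [IsDirectedOrder I] [IsDirectedOrder J] [Nonempty J]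

/-- A direct limit may be computed along a cofinal monotone map of directed index sets. -/
noncomputable def directLimitEquivOfCofinal (hs : Monotone s) (hcof : ∀ i, ∃ j, i ≤ s j) :
    Module.DirectLimit (fun j => G (s j)) (fun _ _ h => f _ _ (hs h)) ≃ₗ[S]
      Module.DirectLimit G f :=
  .ofBijective (Module.DirectLimit.lift S J _ _ (fun j => Module.DirectLimit.of S I G f (s j))
    fun _ _ _ _ => Module.DirectLimit.of_f) <| by
  have : Nonempty I := .map s inferInstance
  have := directedSystem_comp f hs
  refine ⟨(injective_iff_map_eq_zero _).2 fun z hz => ?_, fun z => ?_⟩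
  · obtain ⟨j, x, rfl⟩ := Module.DirectLimit.exists_of z
    rw [Module.DirectLimit.lift_of] at hz
    obtain ⟨i, hji, hx⟩ := Module.DirectLimit.of.zero_exact hz
    obtain ⟨k, hik⟩ := hcof i
    obtain ⟨m, hjm, hkm⟩ := exists_ge_ge j k
    have hxm : f _ _ (hs hjm) x = 0 := by
      rw [← DirectedSystem.map_map' f hji (hik.trans (hs hkm)), hx, map_zero]
    rw [← Module.DirectLimit.of_f (hij := hjm), hxm, map_zero]
  · obtain ⟨i, x, rfl⟩ := Module.DirectLimit.exists_of z
    obtain ⟨j, hij⟩ := hcof i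
    exact ⟨Module.DirectLimit.of S J _ _ j (f i _ hij x), by
      rw [Module.DirectLimit.lift_of, Module.DirectLimit.of_f]⟩

end Cofinal

end ModuleClass

/-- Right `R`-modules are modules over `Rᵐᵒᵖ`; classes of modules are object properties. -/
theorem mainTheorem5 {R : Type u} [Ring R]
    (A' A : ObjectProperty (ModuleCat.{u} Rᵐᵒᵖ))
    [A'.IsClosedUnderIsomorphisms] [A.IsClosedUnderIsomorphisms]
    (hle : A' ≤ A)
    (hsum : ModuleClass.ClosedUnderCountableDirectSums A')
    (hdec : ModuleClass.IsDeconstructible A)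
    (htrans : ModuleClass.ClosedUnderTransfiniteExtensions A)
    (hsummand : ModuleClass.ClosedUnderDirectSummands A)
    (hdense : ∀ M : ModuleCat.{u} Rᵐᵒᵖ, ModuleClass.HasDenseSystem (ℵ_ 1) A' M → A M)
    {I : Type w} [Preorder I] [Nonempty I] [IsDirectedOrder I] [Countable I] [DecidableEq I]
    (G : I → ModuleCat.{u} Rᵐᵒᵖ)
    (f : ∀ i j, i ≤ j → G i →ₗ[Rᵐᵒᵖ] G j)
    [DirectedSystem (fun i => (G i : Type u)) fun i j h => f i j h]
    (hG : ∀ i, A' (G i))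
    (N : ModuleCat.{u} Rᵐᵒᵖ)
    (e : N ≃ₗ[Rᵐᵒᵖ] Module.DirectLimit (fun i => (G i : Type u)) f) :
    A N := by
  obtain ⟨s, hs, hcof⟩ := Filter.exists_seq_monotone_tendsto_atTop_atTop I
  have hcofinal (i : I) : ∃ n, i ≤ s n := (hcof.eventually_ge_atTop i).exists
  have := ModuleClass.directedSystem_comp f hs
  let e' := (ModuleClass.directLimitEquivOfCofinal f hs hcofinal).trans e.symm
  exact A.prop_of_iso e'.toModuleIso
    (ModuleClass.directLimit_nat_mem hsum hdec htrans hsummand hdense fun n => hG (s n))
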